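/- **Proposition 4.2.** Let $0<\alpha<2$ and let $\Omega:\mathbb R\to(0,\infty)$ be a $C^\infty$ function; put $A=\Omega''+2\Omega'$. Assume: 1. $\Omega'(t)<0$ and $\int_{-\infty}^t e^{2\tau}A(\tau)\,d\tau<0$ for all $t\in\mathbb R$; 2. there are $0<M_1<M$, $c_0>0$ and $\Omega(-\infty)\in\mathbb R$ such that $\Omega(t)=\Omega(-\infty)-c_0e^{2t}$ for all $t\le\log M_1$, and $\Omega'(t)+2\Omega(t)=e^{-\alpha t}$ for all $t\ge\log M$ (that is, the vorticity profile $G$ given by $G(e^t)=\Omega'(t)+2\Omega(t)$ satisfies $G(s)=s^{-\alpha}$ for $s\ge M$); 3. $A$ has exactly two zeros $a<b$, and $A'(a)>0$, $A'(b)<0$. Let $d$ be either of the points $a$, $b$. Then there exist a real number $m_0>1$ and a function $\psi_0\in L^2(\mathbb R)$, $\psi_0\not\equiv0$, of class $C^2$, such that $$-\psi_0''(t)+m_0^2\,\psi_0(t)+\big(\Omega(t)-\Omega(d)\big)^{-1}A(t)\,\psi_0(t)=0\qquad\text{for all } t\in\mathbb R,$$ where the coefficient $(\Omega(t)-\Omega(d))^{-1}A(t)$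 takes at its removable singularity $t=d$ its limit value $A'(d)/\Omega'(d)$. -/

import Mathlib

open scoped ContDiff

namespace EulerInstability

noncomputable section

/-- The function `A = Ω'' + 2 Ω'` attached to an angular velocity profile `Ω`, written in the
logarithmic radial variable `t = log s`. -/
def profileA (Ω : ℝ → ℝ) (t : ℝ) : ℝ :=
  deriv (deriv Ω) t + 2 * deriv Ω t

/-- The vorticity profile `G(s)` of the flow, as a function of the radius `s > 0`.
From `Ω(t) = ∫_{-∞}^t e^{-2(t-τ)} G(e^τ) dτ` one has `G(e^t) = Ω'(t) + 2 Ω(t)`. -/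
def vorticityProfile (Ω : ℝ → ℝ) (s : ℝ) : ℝ :=
  deriv Ω (Real.log s) + 2 * Ω (Real.log s)

/-- The class `𝒞` of profiles `Ω : ℝ → (0, ∞)` with decay exponent `α`, where `a < b` are the two
zeros of `A = Ω'' + 2 Ω'`. -/
structure ClassC (α : ℝ) (Ω : ℝ → ℝ) (a b : ℝ) : Prop where
  smooth : ContDiff ℝ ∞ Ω
  pos : ∀ t, 0 < Ω t
  deriv_neg : ∀ t, deriv Ω t < 0
  integral_neg : ∀ t, ∫ τ in Set.Iic t, Real.exp (2 * τ) * profileA Ω τ < 0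
  /-- There are radii `0 < M₁ < M` such that `Ω(t) = Ω(-∞) - c₀ e^{2t}` for `t ≤ log M₁`, with
  `c₀ > 0`, and `G(s) = s^{-α}` for `s ≥ M`. The number `Ωinf` below is then the limit `Ω(-∞)`. -/
  ends : ∃ M₁ M c₀ Ωinf : ℝ, 0 < M₁ ∧ M₁ < M ∧ 0 < c₀ ∧
    (∀ t ≤ Real.log M₁, Ω t = Ωinf - c₀ * Real.exp (2 * t)) ∧
    (∀ s ≥ M, vorticityProfile Ω s = s ^ (-α))
  lt : a < b
  zeros : ∀ t, profileA Ω t = 0 ↔ t = a ∨ t = b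
  deriv_left : 0 < deriv (profileA Ω) a
  deriv_right : deriv (profileA Ω) b < 0

/-- The potential `v(t) = (Ω(t) - Ω(d))⁻¹ A(t)`. When `A(d) = 0` and `Ω'(d) ≠ 0` the singularity at
`t = d` is removable; there `v` takes its limit value `A'(d) / Ω'(d)`
(see `continuousAt_limitPotential`). -/
def limitPotential (Ω : ℝ → ℝ) (d : ℝ) (t : ℝ) : ℝ :=
  if t = d then deriv (profileA Ω) d / deriv Ω d else (Ω t - Ω d)⁻¹ * profileA Ω t

/-- `ψ` is a classical solution on the whole line of `-ψ'' + m₀² ψ + (Ω - Ω(d))⁻¹ A ψ = 0`. -/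
structure SolvesLimitingEq (Ω : ℝ → ℝ) (d m₀ : ℝ) (ψ : ℝ → ℂ) : Prop where
  contDiff : ContDiff ℝ 2 ψ
  eqn : ∀ t, -deriv (deriv ψ) t + (m₀ : ℂ) ^ 2 * ψ t + (limitPotential Ω d t : ℂ) * ψ t = 0

/-- The value chosen for the potential at `d` is its limit: the potential is continuous there. -/
theorem continuousAt_limitPotential {Ω : ℝ → ℝ} {d : ℝ} (hΩ : ContDiff ℝ ∞ Ω)
    (hd : deriv Ω d ≠ 0) (hA : profileA Ω d = 0) :
    ContinuousAt (limitPotential Ω d) d := by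
  have h1 : ContDiff ℝ ∞ (deriv Ω) := (contDiff_infty_iff_deriv.1 hΩ).2
  have h2 : ContDiff ℝ ∞ (deriv (deriv Ω)) := (contDiff_infty_iff_deriv.1 h1).2
  have hAd : Differentiable ℝ (profileA Ω) :=
    ((h2.differentiable (by simp)).add ((h1.differentiable (by simp)).const_mul 2) :)
  have s1 := (hAd d).hasDerivAt.tendsto_slope
  have s2 := ((hΩ.differentiable (by simp)) d).hasDerivAt.tendsto_slope
  rw [continuousAt_iff_punctured_nhds]
  have := s1.div s2 hd
  rw [show limitPotential Ω d d = deriv (profileA Ω) d / deriv Ω d from if_pos rfl]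
  refine this.congr' ?_
  filter_upwards [self_mem_nhdsWithin] with t ht
  have ht' : t - d ≠ 0 := sub_ne_zero.2 ht
  rw [limitPotential, if_neg (show t ≠ d from ht)]
  simp only [Pi.div_apply, slope_def_field, hA, sub_zero]
  rw [div_div_div_cancel_right₀ ht']
  rw [div_eq_inv_mul]

end

end EulerInstability

namespace EulerInstability

open Set Filter Topology MeasureTheory

/-! With `v` the limiting potential and `μ = m₀²`, the equation reads `f'' = (μ + v) f`. At `μ = 1`
it has the explicit solution `e^t (Ω - Ω(d))`, which decays at `-∞`, vanishes at `d`, and is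
negative and decreasing to the right of `d`. As in Sturm oscillation theory, this zero forces an
eigenvalue `-μ` of `-ψ'' + v ψ` below `-1`.

Prüfer angles, `f = ρ sin θ` and `f' = ρ cos θ`, make this concrete. Shooting from `-T`, the angle
has reached `π` by time `T` when `μ = 1`, but stays at most `π / 2` when `μ` is large; some `μ` in
between gives exactly `π` at `T` (`exists_isPhase_eq_pi`). Since `μ + v > 0` far out, that angle
lies in the first quadrant on the far left and in the second on the far right, and compactness lets
`T → ∞` (`exists_isPhase_global`). The quadrants fix the sign of `f f'`, which gives square
integrability (`integrableOn_sq_Ioi_of_mul_nonpos`). A Wronskian argument excludes `μ = 1`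
(`IsPhase.false_of_decaying_solution`). -/

/-! ### Scalar ODEs: Grönwall estimate and global existence -/

/-- Two-sided Grönwall estimate for two scalar equations with nearby right-hand sides. -/
theorem dist_le_gronwallBound_abs {F G : ℝ → ℝ → ℝ} {K : NNReal} {ε s : ℝ}
    (hF : ∀ t, LipschitzWith K (F t)) (hFG : ∀ t x, |G t x - F t x| ≤ ε)
    {θ φ : ℝ → ℝ} (hθ : ∀ t, HasDerivAt θ (F t (θ t)) t)
    (hφ : ∀ t, HasDerivAt φ (G t (φ t)) t) (t : ℝ) :
    dist (θ t) (φ t) ≤ gronwallBound (dist (θ s) (φ s)) K ε |t - s| := by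
  have key : ∀ (F G : ℝ → ℝ → ℝ) (θ φ : ℝ → ℝ) (s t : ℝ), (∀ t, LipschitzWith K (F t)) →
      (∀ t x, |G t x - F t x| ≤ ε) → (∀ t, HasDerivAt θ (F t (θ t)) t) →
      (∀ t, HasDerivAt φ (G t (φ t)) t) → s ≤ t →
      dist (θ t) (φ t) ≤ gronwallBound (dist (θ s) (φ s)) K ε (t - s) := by
    intro F G θ φ s t hF hFG hθ hφ hst
    have := dist_le_of_approx_trajectories_ODE (v := F) (K := K) (f := θ) (g := φ)
      (f' := fun t => F t (θ t)) (g' := fun t => G t (φ t)) (εf := 0) (εg := ε) (a := s) (b := t)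
      (δ := dist (θ s) (φ s)) hF (fun x _ => (hθ x).continuousAt.continuousWithinAt)
      (fun x _ => (hθ x).hasDerivWithinAt) (fun x _ => by simp)
      (fun x _ => (hφ x).continuousAt.continuousWithinAt)
      (fun x _ => (hφ x).hasDerivWithinAt) (fun x _ => by simpa [Real.dist_eq] using hFG x _) le_rfl
      t (right_mem_Icc.2 hst)
    simpa using this
  rcases le_total s t with h | h
  · rw [abs_of_nonneg (sub_nonneg.2 h)]
    exact key F G θ φ s t hF hFG hθ hφ h
  · rw [abs_of_nonpos (sub_nonpos.2 h)]
    -- Reversing time turns backward estimates into forward ones, with the same Lipschitz constant.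
    have := key (fun t x => -F (-t) x) (fun t x => -G (-t) x) (fun t => θ (-t)) (fun t => φ (-t))
      (-s) (-t) (fun t => (hF (-t)).neg) (fun t x => by
        rw [neg_sub_neg, abs_sub_comm]; exact hFG _ _)
      (fun t => by simpa [Function.comp_def] using (hθ (-t)).comp t (hasDerivAt_neg t))
      (fun t => by simpa [Function.comp_def] using (hφ (-t)).comp t (hasDerivAt_neg t)) (by linarith)
    simp only [neg_neg] at this
    convert this using 1
    ring_nf

/-- A scalar equation with bounded, globally Lipschitz right-hand side has global solutions. -/
theorem exists_global_solution {F : ℝ → ℝ → ℝ} {K : NNReal} {C : ℝ}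
    (hFt : ∀ x, Continuous (fun t => F t x)) (hF : ∀ t, LipschitzWith K (F t))
    (hC : ∀ t x, |F t x| ≤ C) (s x : ℝ) :
    ∃ θ : ℝ → ℝ, θ s = x ∧ ∀ t, HasDerivAt θ (F t (θ t)) t := by
  have hC0 : 0 ≤ C := (abs_nonneg _).trans (hC 0 0)
  have loc : ∀ n : ℕ, ∃ θ : ℝ → ℝ, θ s = x ∧
      ∀ t ∈ Icc (s - (n + 1)) (s + (n + 1)),
        HasDerivWithinAt θ (F t (θ t)) (Icc (s - (n + 1)) (s + (n + 1))) t := by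
    intro n
    have hs : s ∈ Icc (s - ((n : ℝ) + 1)) (s + (n + 1)) := by
      constructor <;> linarith [(Nat.cast_nonneg n : (0 : ℝ) ≤ n)]
    -- The global bound `C` keeps the solution in the ball of radius `C (n + 1)`, so the length of
    -- the interval is unrestricted.
    have hpl : IsPicardLindelof F (⟨s, hs⟩ : Icc (s - ((n : ℝ) + 1)) (s + (n + 1))) x
        (⟨C, hC0⟩ * (n + 1)) 0 ⟨C, hC0⟩ K :=
      { lipschitzOnWith := fun t _ => (hF t).lipschitzOnWith
        continuousOn := fun x _ => (hFt x).continuousOn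
        norm_le := fun t _ x _ => hC t x
        mul_max_le := by simp only [add_sub_cancel_left, sub_sub_cancel, max_self]; simp; exact le_rfl }
    obtain ⟨θ, h1, h2⟩ := hpl.exists_eq_forall_mem_Icc_hasDerivWithinAt₀
    exact ⟨θ, h1, h2⟩
  choose θ h0 hθ using loc
  have huniq : ∀ n m : ℕ, n ≤ m → EqOn (θ n) (θ m) (Icc (s - (n + 1)) (s + (n + 1))) := by
    intro n m hnm
    have hnm' : (n : ℝ) ≤ m := by exact_mod_cast hnm
    have hn0 : (0 : ℝ) ≤ n := Nat.cast_nonneg n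
    have hsub : Icc (s - ((n : ℝ) + 1)) (s + (n + 1)) ⊆ Icc (s - ((m : ℝ) + 1)) (s + (m + 1)) :=
      Icc_subset_Icc (by linarith) (by linarith)
    have hd : ∀ k : ℕ, n ≤ k → ∀ t ∈ Ioo (s - ((n : ℝ) + 1)) (s + (n + 1)),
        HasDerivAt (θ k) (F t (θ k t)) t := by
      intro k hk t ht
      have hk' : (n : ℝ) ≤ k := by exact_mod_cast hk
      exact (hθ k t ⟨by linarith [ht.1], by linarith [ht.2]⟩).hasDerivAt
        (Icc_mem_nhds (by linarith [ht.1]) (by linarith [ht.2]))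
    exact ODE_solution_unique_of_mem_Icc (v := F) (s := fun _ => univ) (K := K) (t₀ := s)
      (fun t _ => (hF t).lipschitzOnWith) ⟨by linarith, by linarith⟩
      (fun t ht => (hθ n t ht).continuousWithinAt) (hd n le_rfl)
      (fun _ _ => trivial)
      (fun t ht => ((hθ m t (hsub ht)).mono hsub).continuousWithinAt) (hd m hnm)
      (fun _ _ => trivial) ((h0 n).trans (h0 m).symm)
  refine ⟨fun t => θ ⌈|t - s|⌉₊ t, h0 _, fun t => ?_⟩
  -- The extra `1` puts `t` in the interior of the interval, where one fixed `θ N` represents the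
  -- glued function.
  set N := ⌈|t - s|⌉₊ + 1 with hN
  have hmemN : ∀ u : ℝ, |u - s| < N → θ ⌈|u - s|⌉₊ u = θ N u := by
    intro u hu
    refine huniq _ _ (Nat.ceil_le.2 hu.le) ?_
    have := Nat.le_ceil |u - s|
    constructor <;> linarith [(abs_le.1 this).1, (abs_le.1 this).2]
  have ht : |t - s| < N := by
    have := Nat.le_ceil |t - s|
    rw [hN]; push_cast; linarith
  have hev : (fun u => θ ⌈|u - s|⌉₊ u) =ᶠ[𝓝 t] θ N := by
    have : ∀ᶠ u in 𝓝 t, |u - s| < N :=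
      (by fun_prop : Continuous fun u : ℝ => |u - s|).continuousAt.eventually_lt
        continuousAt_const ht
    exact this.mono hmemN
  refine HasDerivAt.congr_deriv ?_ (congrArg (F t) (hmemN t ht)).symm
  refine HasDerivAt.congr_of_eventuallyEq ?_ hev
  rw [abs_lt] at ht
  exact (hθ N t ⟨by linarith, by linarith⟩).hasDerivAt
    (Icc_mem_nhds (by linarith) (by linarith))

/-! ### Prüfer angles -/

/-- `θ` is a Prüfer angle of the equation `f'' = (μ + v) f`. -/
def IsPhase (v : ℝ → ℝ) (μ : ℝ) (θ : ℝ → ℝ) : Prop :=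
  ∀ t, HasDerivAt θ (1 - (1 + μ + v t) * Real.sin (θ t) ^ 2) t

theorem abs_sin_sq_sub_sin_sq_le (x y : ℝ) :
    |Real.sin x ^ 2 - Real.sin y ^ 2| ≤ 2 * |x - y| := by
  have h1 : |Real.sin x - Real.sin y| ≤ |x - y| := by
    simpa [Real.dist_eq] using Real.lipschitzWith_sin.dist_le_mul x y
  have h2 : |Real.sin x + Real.sin y| ≤ 2 :=
    (abs_add_le _ _).trans (by linarith [Real.abs_sin_le_one x, Real.abs_sin_le_one y])
  rw [sq_sub_sq, abs_mul]
  exact mul_le_mul h2 h1 (abs_nonneg _) (by norm_num)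

theorem lipschitzWith_phase {v : ℝ → ℝ} {V : ℝ} (hV : ∀ t, |v t| ≤ V) (μ t : ℝ) :
    LipschitzWith (Real.toNNReal (2 * (1 + |μ| + V)))
      (fun x => 1 - (1 + μ + v t) * Real.sin x ^ 2) := by
  have hV0 : 0 ≤ V := (abs_nonneg _).trans (hV 0)
  refine LipschitzWith.of_dist_le_mul fun x y => ?_
  rw [Real.coe_toNNReal _ (by positivity), Real.dist_eq, Real.dist_eq]
  have h1 : |1 + μ + v t| ≤ 1 + |μ| + V := by
    refine (abs_add_three _ _ _).trans ?_
    rw [abs_one]; linarith [hV t]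
  calc _ = |1 + μ + v t| * |Real.sin x ^ 2 - Real.sin y ^ 2| := by
        rw [← abs_mul, ← abs_neg]; ring_nf
    _ ≤ (1 + |μ| + V) * (2 * |x - y|) :=
        mul_le_mul h1 (abs_sin_sq_sub_sin_sq_le x y) (abs_nonneg _) (by positivity)
    _ = _ := by ring

theorem exists_isPhase {v : ℝ → ℝ} (hv : Continuous v) {V : ℝ} (hV : ∀ t, |v t| ≤ V)
    (μ s x : ℝ) : ∃ θ : ℝ → ℝ, θ s = x ∧ IsPhase v μ θ := by
  refine exists_global_solution (C := 1 + (1 + |μ| + V))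
    (F := fun t x => 1 - (1 + μ + v t) * Real.sin x ^ 2)
    (fun x => by fun_prop) (lipschitzWith_phase hV μ) (fun t x => ?_) s x
  have h1 : |1 + μ + v t| ≤ 1 + |μ| + V := by
    refine (abs_add_three _ _ _).trans ?_
    rw [abs_one]; linarith [hV t]
  have h2 : |Real.sin x ^ 2| ≤ 1 := by
    rw [abs_of_nonneg (sq_nonneg _)]; exact Real.sin_sq_le_one x
  refine (abs_sub _ _).trans ?_
  rw [abs_one, abs_mul]
  nlinarith [abs_nonneg (1 + μ + v t), abs_nonneg (Real.sin x ^ 2)]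

/-- Changing the parameter perturbs the right-hand side by `(ν - μ) sin²`, at most `|ν - μ|`.
Uniqueness and continuous dependence both follow from this. -/
theorem IsPhase.dist_le {v : ℝ → ℝ} {V : ℝ} (hV : ∀ t, |v t| ≤ V) {μ ν : ℝ} {θ φ : ℝ → ℝ}
    (hθ : IsPhase v μ θ) (hφ : IsPhase v ν φ) (s t : ℝ) :
    dist (φ t) (θ t) ≤ gronwallBound (dist (φ s) (θ s)) (2 * (1 + |μ| + V)) (dist ν μ) |t - s| := by
  have hV0 : 0 ≤ V := (abs_nonneg _).trans (hV 0)
  have := dist_le_gronwallBound_abs (s := s) (ε := dist ν μ) (lipschitzWith_phase hV μ)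
    (G := fun t x => 1 - (1 + ν + v t) * Real.sin x ^ 2) (fun t x => ?_) hθ hφ t
  · rw [Real.coe_toNNReal _ (by positivity), dist_comm (θ t), dist_comm (θ s)] at this
    exact this
  · rw [show 1 - (1 + ν + v t) * Real.sin x ^ 2 - (1 - (1 + μ + v t) * Real.sin x ^ 2)
      = -((ν - μ) * Real.sin x ^ 2) by ring, abs_neg, abs_mul, Real.dist_eq,
      abs_of_nonneg (sq_nonneg (Real.sin x))]
    exact mul_le_of_le_one_right (abs_nonneg _) (Real.sin_sq_le_one x)

theorem IsPhase.unique {v : ℝ → ℝ} {V : ℝ} (hV : ∀ t, |v t| ≤ V) {μ : ℝ} {θ φ : ℝ → ℝ}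
    (hθ : IsPhase v μ θ) (hφ : IsPhase v μ φ) {s : ℝ} (h : θ s = φ s) : θ = φ := by
  funext t
  have := hφ.dist_le hV hθ s t
  rw [h, dist_self, dist_self, gronwallBound_ε0_δ0] at this
  exact dist_le_zero.1 this

/-- Prüfer angles depend continuously on the parameter and on the initial value. -/
theorem continuous_phase {v : ℝ → ℝ} {V : ℝ} (hV : ∀ t, |v t| ≤ V)
    {Θ : ℝ → ℝ → ℝ → ℝ} {s : ℝ} (h0 : ∀ μ x, Θ μ x s = x) (hΘ : ∀ μ x, IsPhase v μ (Θ μ x))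
    (t : ℝ) : Continuous fun p : ℝ × ℝ => Θ p.1 p.2 t := by
  have hV0 : 0 ≤ V := (abs_nonneg _).trans (hV 0)
  rw [continuous_iff_continuousAt]
  rintro ⟨μ, x⟩
  rw [ContinuousAt, tendsto_iff_dist_tendsto_zero]
  have hK : 2 * (1 + |μ| + V) ≠ 0 := by positivity
  refine squeeze_zero (fun _ => dist_nonneg)
    (fun p => (hΘ μ x).dist_le hV (hΘ p.1 p.2) s t) ?_
  simp only [h0, gronwallBound_of_K_ne_0 hK]
  have : Continuous fun p : ℝ × ℝ => dist p.2 x * Real.exp (2 * (1 + |μ| + V) * |t - s|) +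
      dist p.1 μ / (2 * (1 + |μ| + V)) * (Real.exp (2 * (1 + |μ| + V) * |t - s|) - 1) := by
    fun_prop
  simpa using this.tendsto (μ, x)

/-- A Prüfer angle can cross a multiple of `π` only upwards. -/
theorem IsPhase.le_of_sin_eq_zero {v : ℝ → ℝ} {μ : ℝ} {θ : ℝ → ℝ} (hθ : IsPhase v μ θ) {c s t : ℝ}
    (hc : Real.sin c = 0) (hs : c ≤ θ s) (hst : s ≤ t) : c ≤ θ t := by
  have := image_le_of_deriv_right_lt_deriv_boundary' (a := s) (b := t) (f := fun _ => c)
    (f' := fun _ => 0) (B := θ) (B' := fun t => 1 - (1 + μ + v t) * Real.sin (θ t) ^ 2)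
    continuousOn_const (fun x _ => hasDerivWithinAt_const _ _ _) hs
    (fun x _ => (hθ x).continuousAt.continuousWithinAt) (fun x _ => (hθ x).hasDerivWithinAt)
    -- Where `sin θ = 0` the slope of `θ` is `1`, whatever `μ` and `v` are.
    (fun x _ hx => by rw [← hx, hc]; norm_num)
  exact this (right_mem_Icc.2 hst)

/-- Touching `c` at time `t` from above would make the left slope nonpositive, whereas the equation
gives slope `1`. -/
theorem IsPhase.lt_of_sin_eq_zero {v : ℝ → ℝ} {μ : ℝ} {θ : ℝ → ℝ} (hθ : IsPhase v μ θ) {c s t : ℝ}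
    (hc : Real.sin c = 0) (hs : c ≤ θ s) (hst : s < t) : c < θ t := by
  refine (hθ.le_of_sin_eq_zero hc hs hst.le).lt_of_ne fun h => ?_
  have hd := hθ t
  rw [← h, hc] at hd
  have hslope := (hasDerivAt_iff_tendsto_slope.1 hd).mono_left
    (nhdsWithin_mono t (fun x (hx : x ∈ Iio t) => ne_of_lt hx))
  have hle : 1 - (1 + μ + v t) * (0 : ℝ) ^ 2 ≤ 0 := by
    refine le_of_tendsto hslope ?_
    filter_upwards [Ioo_mem_nhdsLT hst] with x hx
    rw [slope_def_field]
    exact div_nonpos_of_nonneg_of_nonpos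
      (by linarith [hθ.le_of_sin_eq_zero hc hs hx.1.le]) (by linarith [hx.2])
  norm_num at hle

/-- Where `μ + v > 0`, a Prüfer angle can cross `π / 2` only downwards. -/
theorem IsPhase.le_pi_div_two {v : ℝ → ℝ} {μ : ℝ} {θ : ℝ → ℝ} (hθ : IsPhase v μ θ) {s t : ℝ}
    (hpos : ∀ u, s ≤ u → u < t → 0 < μ + v u) (hs : θ s ≤ Real.pi / 2) (hst : s ≤ t) :
    θ t ≤ Real.pi / 2 := by
  have := image_le_of_deriv_right_lt_deriv_boundary' (a := s) (b := t) (f := θ)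
    (f' := fun t => 1 - (1 + μ + v t) * Real.sin (θ t) ^ 2) (B := fun _ => Real.pi / 2)
    (B' := fun _ => 0) (fun x _ => (hθ x).continuousAt.continuousWithinAt)
    (fun x _ => (hθ x).hasDerivWithinAt) hs continuousOn_const
    (fun x _ => hasDerivWithinAt_const _ _ _)
    -- At `π / 2` the slope is `-(μ + v)`.
    (fun x hx h => by rw [h, Real.sin_pi_div_two]; linarith [hpos x hx.1 hx.2])
  exact this (right_mem_Icc.2 hst)

/-- If a solution `f` of `f'' = (μ + v) f` and a Prüfer angle agree at one point, they agree
everywhere. -/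
theorem IsPhase.proportional {v : ℝ → ℝ} (hv : Continuous v) {μ : ℝ} {θ f g : ℝ → ℝ}
    (hθ : IsPhase v μ θ) (hf : ∀ t, HasDerivAt f (g t) t)
    (hg : ∀ t, HasDerivAt g ((μ + v t) * f t) t) {s : ℝ}
    (h : f s * Real.cos (θ s) = g s * Real.sin (θ s)) {t : ℝ} (hst : s ≤ t) :
    f t * Real.cos (θ t) = g t * Real.sin (θ t) := by
  have hcont : Continuous θ := continuous_iff_continuousAt.2 fun t => (hθ t).continuousAt
  -- The determinant of `(f, g)` and `(sin θ, cos θ)` solves a linear homogeneous first-order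
  -- equation, so it stays zero.
  set w : ℝ → ℝ := fun t => f t * Real.cos (θ t) - g t * Real.sin (θ t) with hw
  set k : ℝ → ℝ := fun t => (1 + μ + v t) * (Real.sin (θ t) * Real.cos (θ t)) with hk
  have hkc : Continuous k := by fun_prop
  have hdw : ∀ t, HasDerivAt w (-(k t) * w t) t := by
    intro t
    have := ((hf t).mul (hθ t).cos).sub ((hg t).mul (hθ t).sin)
    refine this.congr_deriv ?_
    simp only [hw, hk]
    linear_combination ((1 + μ + v t) * f t * Real.sin (θ t)) * (Real.sin_sq_add_cos_sq (θ t))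
  obtain ⟨C, hC⟩ := isCompact_Icc.exists_bound_of_continuousOn (hkc.continuousOn (s := Icc s t))
  have := eq_zero_of_abs_deriv_le_mul_abs_self_of_eq_zero_right (a := s) (b := t) (K := C)
    (fun x _ => (hdw x).continuousAt.continuousWithinAt) (fun x _ => (hdw x).hasDerivWithinAt)
    (by simp [hw, h]) (fun x hx => by
      rw [norm_mul, norm_neg]
      exact mul_le_mul_of_nonneg_right (hC x ⟨hx.1, hx.2.le⟩) (norm_nonneg _)) t
    (right_mem_Icc.2 hst)
  simpa [hw, sub_eq_zero] using this

/-- The solution of `f'' = (μ + v) f` reconstructed from a Prüfer angle. -/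
theorem IsPhase.exists_amplitude {v : ℝ → ℝ} (hv : Continuous v) {μ : ℝ} {θ : ℝ → ℝ}
    (hθ : IsPhase v μ θ) : ∃ ρ : ℝ → ℝ, (∀ t, 0 < ρ t) ∧
      (∀ t, HasDerivAt (fun t => ρ t * Real.sin (θ t)) (ρ t * Real.cos (θ t)) t) ∧
      (∀ t, HasDerivAt (fun t => ρ t * Real.cos (θ t))
        ((μ + v t) * (ρ t * Real.sin (θ t))) t) ∧
      ∀ t, HasDerivAt ρ ((1 + μ + v t) * (Real.sin (θ t) * Real.cos (θ t)) * ρ t) t := by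
  have hcont : Continuous θ := continuous_iff_continuousAt.2 fun t => (hθ t).continuousAt
  set k : ℝ → ℝ := fun t => (1 + μ + v t) * (Real.sin (θ t) * Real.cos (θ t)) with hk
  have hkc : Continuous k := by fun_prop
  -- Requiring `(ρ sin θ)' = ρ cos θ` forces `ρ' = k ρ`.
  set ρ : ℝ → ℝ := fun t => Real.exp (∫ u in (0 : ℝ)..t, k u) with hρ
  have hdρ : ∀ t, HasDerivAt ρ (k t * ρ t) t := by
    intro t
    have := (hkc.integral_hasStrictDerivAt 0 t).hasDerivAt.exp
    simpa [mul_comm] using this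
  refine ⟨ρ, fun t => Real.exp_pos _, fun t => ?_, fun t => ?_, hdρ⟩
  · refine ((hdρ t).mul (hθ t).sin).congr_deriv ?_
    simp only [hk]
    ring
  · refine ((hdρ t).mul (hθ t).cos).congr_deriv ?_
    simp only [hk]
    linear_combination ((1 + μ + v t) * ρ t * Real.sin (θ t)) * (Real.sin_sq_add_cos_sq (θ t))

/-! ### Shooting and compactness -/

/-- For a suitable parameter, the Prüfer angle starting at `-T` on the reference solution `f`
reaches `π` exactly at `T`. -/
theorem exists_isPhase_eq_pi {v : ℝ → ℝ} (hv : Continuous v) {V : ℝ} (hV : ∀ t, |v t| ≤ V)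
    {f g : ℝ → ℝ} {d R T : ℝ} (hf : ∀ t, HasDerivAt f (g t) t)
    (hg : ∀ t, HasDerivAt g ((1 + v t) * f t) t) (hfd : f d = 0) (hgd : g d ≠ 0)
    (hR : 0 < R) (hRT : R < T) (hdl : -R < d) (hdr : d < R)
    (hvl : ∀ t ≤ -R, |v t| ≤ 1 / 2) (hvr : ∀ t ≥ R, |v t| ≤ 1 / 2)
    (hfT : 0 < f (-T)) (hgT : 0 < g (-T)) :
    ∃ μ ∈ Icc 1 (V + 2), ∃ θ, IsPhase v μ θ ∧ θ 0 ∈ Icc 0 Real.pi ∧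
      (∀ t ∈ Icc (-T) (-R), θ t ∈ Icc 0 (Real.pi / 2)) ∧
      ∀ t ∈ Icc R T, θ t ∈ Icc (Real.pi / 2) Real.pi := by
  have hV0 : 0 ≤ V := (abs_nonneg _).trans (hV 0)
  have hπ := Real.pi_pos
  choose Θ h0 hΘ using fun μ x => exists_isPhase hv hV μ (-T) x
  -- The Prüfer angle of `f` itself at `-T`, in the first quadrant because `f` and `g` are positive
  -- there.
  set γ := Real.arctan (f (-T) / g (-T)) with hγ
  have hγ0 : 0 < γ := Real.arctan_pos.2 (div_pos hfT hgT)
  have hγ1 : γ ≤ Real.pi / 2 := (Real.arctan_lt_pi_div_two _).le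
  have hmatch : f (-T) * Real.cos γ = g (-T) * Real.sin γ := by
    have h1 : Real.tan γ = f (-T) / g (-T) := Real.tan_arctan _
    have h2 : Real.tan γ * Real.cos γ = Real.sin γ :=
      Real.tan_mul_cos (Real.cos_arctan_pos _).ne'
    rw [← h2, h1]
    field_simp
  -- At `μ = 1` the angle follows `f`, so its sine vanishes at `d`. Being positive, it is at least
  -- `π` there and cannot come back down.
  have hlow : Real.pi ≤ Θ 1 γ T := by
    have hpr := (hΘ 1 γ).proportional hv hf hg (s := -T) (t := d) (by rw [h0]; exact hmatch)
      (by linarith)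
    rw [hfd, zero_mul] at hpr
    have hs : Real.sin (Θ 1 γ d) = 0 := (mul_eq_zero.1 hpr.symm).resolve_left hgd
    have hp : 0 < Θ 1 γ d :=
      (hΘ 1 γ).lt_of_sin_eq_zero Real.sin_zero (s := -T) (by rw [h0]; exact hγ0.le) (by linarith)
    have hd : Real.pi ≤ Θ 1 γ d := by
      by_contra! h
      exact (Real.sin_pos_of_pos_of_lt_pi hp h).ne' hs
    exact (hΘ 1 γ).le_of_sin_eq_zero Real.sin_pi hd (by linarith)
  -- At `μ = V + 2` one has `μ + v ≥ 2` everywhere, so the angle never passes `π / 2`.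
  have hhigh : Θ (V + 2) γ T ≤ Real.pi := by
    have := (hΘ (V + 2) γ).le_pi_div_two (s := -T) (t := T)
      (fun u _ _ => by linarith [(abs_le.1 (hV u)).1]) (by rw [h0]; exact hγ1) (by linarith)
    linarith
  have hcont : Continuous fun μ => Θ μ γ T :=
    (continuous_phase hV h0 hΘ T).comp (by fun_prop : Continuous fun μ : ℝ => (μ, γ))
  obtain ⟨μ, hμ, hμT⟩ := intermediate_value_Icc' (by linarith : (1 : ℝ) ≤ V + 2)
    hcont.continuousOn ⟨hhigh, hlow⟩
  have hpos : ∀ t, (t ≤ -R ∨ R ≤ t) → 0 < μ + v t := by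
    rintro t (h | h)
    · linarith [(abs_le.1 (hvl t h)).1, hμ.1]
    · linarith [(abs_le.1 (hvr t h)).1, hμ.1]
  have hθ := hΘ μ γ
  have hnonneg : ∀ t, -T ≤ t → 0 ≤ Θ μ γ t := fun t ht =>
    hθ.le_of_sin_eq_zero Real.sin_zero (s := -T) (by rw [h0]; exact hγ0.le) ht
  have hlepi : ∀ t, t ≤ T → Θ μ γ t ≤ Real.pi := by
    intro t ht
    by_contra! h
    rcases ht.eq_or_lt with rfl | ht
    · exact h.ne' hμT
    · exact (hθ.lt_of_sin_eq_zero Real.sin_pi h.le ht).ne' hμT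
  refine ⟨μ, hμ, Θ μ γ, hθ, ⟨hnonneg 0 (by linarith), hlepi 0 (by linarith)⟩,
    fun t ht => ⟨hnonneg t ht.1, ?_⟩, fun t ht => ⟨?_, hlepi t ht.2⟩⟩
  · exact hθ.le_pi_div_two (s := -T) (fun u _ hu => hpos u (Or.inl (by linarith [ht.2])))
      (by rw [h0]; exact hγ1) ht.1
  -- An angle below `π / 2` beyond `R` would be trapped there and miss `π` at `T`.
  · by_contra! h
    have := hθ.le_pi_div_two (s := t) (t := T) (fun u hu _ => hpos u (Or.inr (by linarith [ht.1])))
      h.le ht.2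
    simp only at hμT
    linarith

/-- Compactness: a parameter and a Prüfer angle controlled on both half-lines. -/
theorem exists_isPhase_global {v : ℝ → ℝ} (hv : Continuous v) {V : ℝ} (hV : ∀ t, |v t| ≤ V)
    {f g : ℝ → ℝ} {d R : ℝ} (hf : ∀ t, HasDerivAt f (g t) t)
    (hg : ∀ t, HasDerivAt g ((1 + v t) * f t) t) (hfd : f d = 0) (hgd : g d ≠ 0)
    (hR : 0 < R) (hdl : -R < d) (hdr : d < R)
    (hvl : ∀ t ≤ -R, |v t| ≤ 1 / 2) (hvr : ∀ t ≥ R, |v t| ≤ 1 / 2)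
    (hfl : ∀ t ≤ -R, 0 < f t) (hgl : ∀ t ≤ -R, 0 < g t) :
    ∃ μ ≥ 1, ∃ θ, IsPhase v μ θ ∧
      (∀ t ≤ -R, θ t ∈ Icc 0 (Real.pi / 2)) ∧ ∀ t ≥ R, θ t ∈ Icc (Real.pi / 2) Real.pi := by
  choose Θ h0 hΘ using fun μ x => exists_isPhase hv hV μ 0 x
  have hcont := continuous_phase hV h0 hΘ
  set box : Set (ℝ × ℝ) := Icc 1 (V + 2) ×ˢ Icc 0 Real.pi with hbox
  -- Pairs `(μ, θ 0)` whose angle obeys the quadrant conditions up to distance `n + 1` beyond `R`.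
  -- These sets are compact and decreasing, and shooting with `T = R + (n + 1) > R` makes them
  -- nonempty.
  set S : ℕ → Set (ℝ × ℝ) := fun n => box ∩
    ((⋂ t ∈ Icc (-(R + (n + 1))) (-R), (fun p : ℝ × ℝ => Θ p.1 p.2 t) ⁻¹' Icc 0 (Real.pi / 2)) ∩
      ⋂ t ∈ Icc R (R + (n + 1)), (fun p : ℝ × ℝ => Θ p.1 p.2 t) ⁻¹' Icc (Real.pi / 2) Real.pi)
    with hS
  have hboxc : IsCompact box := isCompact_Icc.prod isCompact_Icc
  have hclosed : ∀ n, IsClosed (S n) := fun n =>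
    hboxc.isClosed.inter
      ((isClosed_biInter fun t _ => isClosed_Icc.preimage (hcont t)).inter
        (isClosed_biInter fun t _ => isClosed_Icc.preimage (hcont t)))
  have hne : ∀ n, (S n).Nonempty := by
    intro n
    have hn : (0 : ℝ) ≤ n := Nat.cast_nonneg n
    obtain ⟨μ, hμ, θ, hθ, hθ0, hl, hr⟩ := exists_isPhase_eq_pi hv hV hf hg hfd hgd hR
      (by linarith : R < R + (n + 1)) hdl hdr hvl hvr (hfl _ (by linarith)) (hgl _ (by linarith))
    have heq : Θ μ (θ 0) = θ := (hΘ μ (θ 0)).unique hV hθ (h0 μ (θ 0))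
    refine ⟨(μ, θ 0), ⟨hμ, hθ0⟩, ?_, ?_⟩
    · simp only [mem_iInter, mem_preimage, heq]
      exact hl
    · simp only [mem_iInter, mem_preimage, heq]
      exact hr
  obtain ⟨⟨μ, x⟩, hp⟩ := IsCompact.nonempty_iInter_of_sequence_nonempty_isCompact_isClosed S
    (fun n => by
      refine inter_subset_inter_right _ (inter_subset_inter ?_ ?_) <;>
      · refine biInter_subset_biInter_left (Icc_subset_Icc ?_ ?_) <;> push_cast <;> linarith)
    hne (hboxc.of_isClosed_subset (hclosed 0) inter_subset_left) hclosed
  rw [mem_iInter] at hp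
  refine ⟨μ, (hp 0).1.1.1, Θ μ x, hΘ μ x, fun t ht => ?_, fun t ht => ?_⟩
  · obtain ⟨n, hn⟩ := exists_nat_ge (-t - R)
    have := (hp n).2.1
    simp only [mem_iInter, mem_preimage] at this
    exact this t ⟨by linarith, ht⟩
  · obtain ⟨n, hn⟩ := exists_nat_ge (t - R)
    have := (hp n).2.2
    simp only [mem_iInter, mem_preimage] at this
    exact this t ⟨ht, by linarith⟩

/-! ### Square integrability and exclusion of `μ = 1` -/

/-- A solution of `f'' = q f` with `q ≥ 1 / 2` and `f f' ≤ 0` near `+∞` is square integrable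
there. -/
theorem integrableOn_sq_Ioi_of_mul_nonpos {q f g : ℝ → ℝ} {R : ℝ}
    (hf : ∀ t, HasDerivAt f (g t) t) (hg : ∀ t, HasDerivAt g (q t * f t) t)
    (hq : ∀ t ≥ R, 1 / 2 ≤ q t) (hfg : ∀ t ≥ R, f t * g t ≤ 0) :
    IntegrableOn (fun t => f t ^ 2) (Ioi R) := by
  have hd : ∀ t, HasDerivAt (fun t => f t * g t) (g t ^ 2 + q t * f t ^ 2) t := fun t =>
    ((hf t).mul (hg t)).congr_deriv (by ring)
  have hnn : ∀ t ≥ R, 0 ≤ g t ^ 2 + q t * f t ^ 2 := fun t ht => by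
    have := hq t ht
    positivity
  have hmono : MonotoneOn (fun t => f t * g t) (Ici R) :=
    monotoneOn_of_hasDerivWithinAt_nonneg (convex_Ici R)
      (fun t _ => (hd t).continuousAt.continuousWithinAt)
      (fun t _ => (hd t).hasDerivWithinAt) (fun t ht => hnn t (interior_subset ht))
  -- Freezing `f g` to the left of `R` makes it monotone on the whole line; bounded above by `0`, it
  -- converges, so its derivative is integrable and dominates `f² / 2`.
  have hmono' : Monotone fun t => f (max R t) * g (max R t) := fun s t hst =>
    hmono (mem_Ici.2 (le_max_left R s)) (mem_Ici.2 (le_max_left R t)) (max_le_max le_rfl hst)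
  obtain ⟨l, hl⟩ : ∃ l, Tendsto (fun t => f t * g t) atTop (𝓝 l) := by
    refine ⟨_, (tendsto_atTop_ciSup hmono' ⟨0, ?_⟩).congr' ?_⟩
    · rintro _ ⟨t, rfl⟩
      exact hfg _ (le_max_left _ _)
    · filter_upwards [eventually_ge_atTop R] with t ht
      simp only [max_eq_right ht]
  have hint := (integrableOn_Ioi_deriv_of_nonneg' (fun t _ => hd t)
    (fun t ht => hnn t (le_of_lt ht)) hl).const_mul 2
  have hfc : Continuous f := continuous_iff_continuousAt.2 fun t => (hf t).continuousAt
  refine Integrable.mono' hint (by fun_prop) ?_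
  filter_upwards [ae_restrict_mem measurableSet_Ioi] with t ht
  rw [Real.norm_of_nonneg (sq_nonneg _)]
  nlinarith [hq t (le_of_lt ht), sq_nonneg (g t), sq_nonneg (f t)]

/-- Reflection `t ↦ -t` reverses the sign of `f f'` and reduces this to the case of `+∞`. -/
theorem integrableOn_sq_Iio_of_mul_nonneg {q f g : ℝ → ℝ} {R : ℝ}
    (hf : ∀ t, HasDerivAt f (g t) t) (hg : ∀ t, HasDerivAt g (q t * f t) t)
    (hq : ∀ t ≤ R, 1 / 2 ≤ q t) (hfg : ∀ t ≤ R, 0 ≤ f t * g t) :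
    IntegrableOn (fun t => f t ^ 2) (Iio R) := by
  have := integrableOn_sq_Ioi_of_mul_nonpos (q := fun t => q (-t)) (f := fun t => f (-t))
    (g := fun t => -g (-t)) (R := -R)
    (fun t => by simpa [Function.comp_def] using (hf (-t)).comp t (hasDerivAt_neg t))
    (fun t => by simpa [Function.comp_def] using ((hg (-t)).comp t (hasDerivAt_neg t)).fun_neg)
    (fun t ht => hq _ (by linarith)) (fun t ht => by
      have := hfg (-t) (by linarith)
      linarith)
  have h2 := (Measure.measurePreserving_neg (volume : Measure ℝ)).integrableOn_comp_preimage
    (Homeomorph.neg ℝ).measurableEmbedding (f := fun t => f t ^ 2) (s := Iio R)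
  refine h2.1 ?_
  simpa [Function.comp_def] using this

/-- A Prüfer angle for `μ = 1` that stays in the first quadrant near `-∞` follows any solution
decaying at `-∞`, and so cannot be in the second quadrant where that solution grows. -/
theorem IsPhase.false_of_decaying_solution {v : ℝ → ℝ} (hv : Continuous v)
    {f g θ : ℝ → ℝ} {R : ℝ} (hf : ∀ t, HasDerivAt f (g t) t)
    (hg : ∀ t, HasDerivAt g ((1 + v t) * f t) t) (hθ : IsPhase v 1 θ)
    (hf0 : Tendsto f atBot (𝓝 0)) (hg0 : Tendsto g atBot (𝓝 0))
    (hvl : ∀ t ≤ -R, |v t| ≤ 1 / 2)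
    (hl : ∀ t ≤ -R, 0 ≤ Real.sin (θ t) * Real.cos (θ t))
    (hfg : 0 < f R * g R) (hr : Real.sin (θ R) * Real.cos (θ R) ≤ 0) : False := by
  obtain ⟨ρ, hρ, h1, h2, h3⟩ := hθ.exists_amplitude hv
  -- The Wronskian of `f` and `ρ sin θ` is constant, both solving the equation with `μ = 1`. Near
  -- `-∞` the amplitude `ρ` is nondecreasing, hence bounded, so the decay of `f` and `g` makes the
  -- constant zero.
  have hW : ∀ t, HasDerivAt (fun t => f t * (ρ t * Real.cos (θ t)) - g t * (ρ t * Real.sin (θ t)))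
      0 t := fun t =>
    (((hf t).mul (h2 t)).sub ((hg t).mul (h1 t))).congr_deriv (by ring)
  have hconst : ∀ s t, f s * (ρ s * Real.cos (θ s)) - g s * (ρ s * Real.sin (θ s)) =
      f t * (ρ t * Real.cos (θ t)) - g t * (ρ t * Real.sin (θ t)) :=
    is_const_of_deriv_eq_zero (fun t => (hW t).differentiableAt) (fun t => (hW t).deriv)
  have hmono : MonotoneOn ρ (Iic (-R)) :=
    monotoneOn_of_hasDerivWithinAt_nonneg (convex_Iic _)
      (fun t _ => (h3 t).continuousAt.continuousWithinAt)
      (fun t _ => (h3 t).hasDerivWithinAt) (fun t ht => by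
        have ht' : t ≤ -R := mem_Iic.1 (interior_subset ht)
        have := (abs_le.1 (hvl t ht')).1
        exact mul_nonneg (mul_nonneg (by linarith) (hl t ht')) (hρ t).le)
  have hlim : Tendsto (fun t => f t * (ρ t * Real.cos (θ t)) - g t * (ρ t * Real.sin (θ t)))
      atBot (𝓝 0) := by
    have hb : Tendsto (fun t => (|f t| + |g t|) * ρ (-R)) atBot (𝓝 0) := by
      simpa using (hf0.abs.add hg0.abs).mul_const (ρ (-R))
    refine squeeze_zero_norm' ?_ hb
    filter_upwards [eventually_le_atBot (-R)] with t ht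
    have hρt : ρ t ≤ ρ (-R) := hmono ht self_mem_Iic ht
    rw [Real.norm_eq_abs]
    refine (abs_sub _ _).trans ?_
    rw [abs_mul, abs_mul, abs_mul, abs_mul, abs_of_pos (hρ t), add_mul]
    refine add_le_add (mul_le_mul_of_nonneg_left ?_ (abs_nonneg _))
      (mul_le_mul_of_nonneg_left ?_ (abs_nonneg _))
    · exact (mul_le_of_le_one_right (hρ t).le (Real.abs_cos_le_one _)).trans hρt
    · exact (mul_le_of_le_one_right (hρ t).le (Real.abs_sin_le_one _)).trans hρt
  have hzero : f R * (ρ R * Real.cos (θ R)) - g R * (ρ R * Real.sin (θ R)) = 0 :=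
    tendsto_nhds_unique (tendsto_const_nhds.congr fun t => hconst R t) hlim
  have heq : f R * Real.cos (θ R) = g R * Real.sin (θ R) := by
    have := (hρ R).ne'
    apply mul_left_cancel₀ this
    linear_combination hzero
  have hfR : f R ≠ 0 := left_ne_zero_of_mul hfg.ne'
  have hgR : g R ≠ 0 := right_ne_zero_of_mul hfg.ne'
  -- Proportionality at `R` equates a square with a nonpositive number, which makes `sin` and `cos`
  -- vanish together.
  have hsq : (f R * Real.cos (θ R)) ^ 2 = (f R * g R) * (Real.sin (θ R) * Real.cos (θ R)) := by
    linear_combination (f R * Real.cos (θ R)) * heq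
  have hle : (f R * Real.cos (θ R)) ^ 2 ≤ 0 := hsq ▸ mul_nonpos_of_nonneg_of_nonpos hfg.le hr
  have hfc : f R * Real.cos (θ R) = 0 := pow_eq_zero_iff two_ne_zero |>.1
    (le_antisymm hle (sq_nonneg _))
  have hc : Real.cos (θ R) = 0 := (mul_eq_zero.1 hfc).resolve_left hfR
  have hs : Real.sin (θ R) = 0 := (mul_eq_zero.1 (heq.symm.trans hfc)).resolve_left hgR
  have := Real.sin_sq_add_cos_sq (θ R)
  rw [hc, hs] at this
  norm_num at this

theorem exists_forall_abs_le_of_tendsto {v : ℝ → ℝ} (hv : Continuous v)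
    (hbot : Tendsto v atBot (𝓝 0)) (htop : Tendsto v atTop (𝓝 0)) : ∃ V, ∀ t, |v t| ≤ V := by
  have h : Tendsto v (cocompact ℝ) (𝓝 0) := by
    rw [cocompact_eq_atBot_atTop]
    exact hbot.sup htop
  let v₀ : ZeroAtInftyContinuousMap ℝ ℝ := ⟨⟨v, hv⟩, h⟩
  obtain ⟨C, hC⟩ := isBounded_iff_forall_norm_le.1 (ZeroAtInftyContinuousMap.isBounded_range v₀)
  exact ⟨C, fun t => hC _ ⟨t, rfl⟩⟩

/-- Let `f'' = (1 + v) f` with `v → 0` at `±∞`, where `f` decays at `-∞`, has a zero, and grows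
at `+∞`. Then `f'' = (μ + v) f` has a nonzero square integrable solution for some `μ > 1`. -/
theorem exists_integrable_solution {v : ℝ → ℝ} (hv : Continuous v)
    (hbot : Tendsto v atBot (𝓝 0)) (htop : Tendsto v atTop (𝓝 0))
    {f g : ℝ → ℝ} {d : ℝ} (hf : ∀ t, HasDerivAt f (g t) t)
    (hg : ∀ t, HasDerivAt g ((1 + v t) * f t) t) (hfd : f d = 0) (hgd : g d ≠ 0)
    (hf0 : Tendsto f atBot (𝓝 0)) (hg0 : Tendsto g atBot (𝓝 0))
    (hfpos : ∀ᶠ t in atBot, 0 < f t) (hgpos : ∀ᶠ t in atBot, 0 < g t)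
    (hfg : ∀ᶠ t in atTop, 0 < f t * g t) :
    ∃ μ > 1, ∃ F G : ℝ → ℝ, (∀ t, HasDerivAt F (G t) t) ∧
      (∀ t, HasDerivAt G ((μ + v t) * F t) t) ∧ Integrable (fun t => F t ^ 2) ∧ F ≠ 0 := by
  obtain ⟨V, hV⟩ := exists_forall_abs_le_of_tendsto hv hbot htop
  have hsmall : ∀ᶠ x in 𝓝 (0 : ℝ), |x| ≤ 1 / 2 := by
    filter_upwards [Metric.closedBall_mem_nhds (0 : ℝ) (by norm_num : (0 : ℝ) < 1 / 2)] with x hx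
    simpa using hx
  obtain ⟨L, hL⟩ := eventually_atBot.1 ((hbot.eventually hsmall).and (hfpos.and hgpos))
  obtain ⟨U, hU⟩ := eventually_atTop.1 ((htop.eventually hsmall).and hfg)
  -- One radius that encloses `d` and lies beyond both thresholds `L` and `U`.
  set R := |L| + |U| + |d| + 1 with hRdef
  have hLR : -R ≤ L := by linarith [neg_abs_le L, abs_nonneg U, abs_nonneg d]
  have hUR : U ≤ R := by linarith [le_abs_self U, abs_nonneg L, abs_nonneg d]
  have hdl : -R < d := by linarith [neg_abs_le d, abs_nonneg U, abs_nonneg L]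
  have hdr : d < R := by linarith [le_abs_self d, abs_nonneg U, abs_nonneg L]
  have hR : 0 < R := by positivity
  have hvl : ∀ t ≤ -R, |v t| ≤ 1 / 2 := fun t ht => (hL t (ht.trans hLR)).1
  have hvr : ∀ t ≥ R, |v t| ≤ 1 / 2 := fun t ht => (hU t (hUR.trans ht)).1
  obtain ⟨μ, hμ, θ, hθ, hl, hr⟩ := exists_isPhase_global hv hV hf hg hfd hgd hR hdl hdr hvl hvr
    (fun t ht => (hL t (ht.trans hLR)).2.1) (fun t ht => (hL t (ht.trans hLR)).2.2)
  have hπ := Real.pi_pos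
  have hscl : ∀ t ≤ -R, 0 ≤ Real.sin (θ t) * Real.cos (θ t) := fun t ht =>
    mul_nonneg (Real.sin_nonneg_of_nonneg_of_le_pi (hl t ht).1 (by linarith [(hl t ht).2]))
      (Real.cos_nonneg_of_neg_pi_div_two_le_of_le (by linarith [(hl t ht).1]) (hl t ht).2)
  have hscr : ∀ t ≥ R, Real.sin (θ t) * Real.cos (θ t) ≤ 0 := fun t ht =>
    mul_nonpos_of_nonneg_of_nonpos
      (Real.sin_nonneg_of_nonneg_of_le_pi (by linarith [(hr t ht).1]) (hr t ht).2)
      (Real.cos_nonpos_of_pi_div_two_le_of_le (hr t ht).1 (by linarith [(hr t ht).2]))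
  have hμ1 : 1 < μ := by
    refine lt_of_le_of_ne hμ ?_
    rintro rfl
    exact hθ.false_of_decaying_solution hv hf hg hf0 hg0 hvl hscl (hU R hUR).2 (hscr R le_rfl)
  obtain ⟨ρ, hρ, h1, h2, -⟩ := hθ.exists_amplitude hv
  refine ⟨μ, hμ1, fun t => ρ t * Real.sin (θ t), fun t => ρ t * Real.cos (θ t), h1, h2, ?_, ?_⟩
  · have hFc : Continuous fun t => ρ t * Real.sin (θ t) :=
      continuous_iff_continuousAt.2 fun t => (h1 t).continuousAt
    have hi1 := integrableOn_sq_Ioi_of_mul_nonpos (R := R) h1 h2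
      (fun t ht => by linarith [(abs_le.1 (hvr t ht)).1])
      (fun t ht => by nlinarith [hscr t ht, sq_nonneg (ρ t)])
    have hi2 := integrableOn_sq_Iio_of_mul_nonneg (R := -R) h1 h2
      (fun t ht => by linarith [(abs_le.1 (hvl t ht)).1])
      (fun t ht => by nlinarith [hscl t ht, sq_nonneg (ρ t)])
    have hi3 : IntegrableOn (fun t => (ρ t * Real.sin (θ t)) ^ 2) (Icc (-R) R) :=
      (hFc.pow 2).continuousOn.integrableOn_Icc
    rw [← integrableOn_univ]
    refine ((hi2.union hi3).union hi1).mono_set fun t _ => ?_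
    rcases lt_or_ge t (-R) with h | h
    · exact Or.inl (Or.inl h)
    · rcases le_or_gt t R with h' | h'
      · exact Or.inl (Or.inr ⟨h, h'⟩)
      · exact Or.inr h'
  · intro hF
    have hF' : ∀ t, Real.sin (θ t) = 0 := fun t =>
      (mul_eq_zero.1 (congrFun hF t)).resolve_left (hρ t).ne'
    have hcos : ρ 0 * Real.cos (θ 0) = 0 := by
      refine (h1 0).unique ?_
      rw [hF]
      exact hasDerivAt_const _ _
    have hc := (mul_eq_zero.1 hcos).resolve_left (hρ 0).ne'
    have := Real.sin_sq_add_cos_sq (θ 0)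
    rw [hc, hF' 0] at this
    norm_num at this

/-! ### The limiting potential of a profile -/

namespace ClassC

variable {α : ℝ} {Ω : ℝ → ℝ} {a b d : ℝ}

theorem contDiff_deriv (h : ClassC α Ω a b) : ContDiff ℝ ∞ (deriv Ω) :=
  (contDiff_infty_iff_deriv.1 h.smooth).2

theorem hasDerivAt (h : ClassC α Ω a b) (t : ℝ) : HasDerivAt Ω (deriv Ω t) t :=
  (h.smooth.differentiable (by simp) t).hasDerivAt

theorem hasDerivAt_deriv (h : ClassC α Ω a b) (t : ℝ) :
    HasDerivAt (deriv Ω) (deriv (deriv Ω) t) t :=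
  (h.contDiff_deriv.differentiable (by simp) t).hasDerivAt

theorem strictAnti (h : ClassC α Ω a b) : StrictAnti Ω := strictAnti_of_deriv_neg h.deriv_neg

theorem continuous_profileA (h : ClassC α Ω a b) : Continuous (profileA Ω) :=
  ((contDiff_infty_iff_deriv.1 h.contDiff_deriv).2.continuous).add
    (continuous_const.mul h.contDiff_deriv.continuous)

/-- Since `A(d) = 0`, this holds at `d` too, so the equation can be checked without treating the
singularity apart. -/
theorem limitPotential_mul (h : ClassC α Ω a b) (hA : profileA Ω d = 0) (t : ℝ) :
    limitPotential Ω d t * (Ω t - Ω d) = profileA Ω t := by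
  by_cases htd : t = d
  · rw [htd, sub_self, mul_zero, hA]
  · have : Ω t - Ω d ≠ 0 := sub_ne_zero.2 (h.strictAnti.injective.ne htd)
    rw [limitPotential, if_neg htd]
    field_simp

theorem continuous_limitPotential (h : ClassC α Ω a b) (hA : profileA Ω d = 0) :
    Continuous (limitPotential Ω d) := by
  rw [continuous_iff_continuousAt]
  intro t
  by_cases htd : t = d
  · rw [htd]
    exact continuousAt_limitPotential h.smooth (h.deriv_neg d).ne hA
  · have hw : Ω t - Ω d ≠ 0 := sub_ne_zero.2 (h.strictAnti.injective.ne htd)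
    have hc : ContinuousAt (fun u => (Ω u - Ω d)⁻¹ * profileA Ω u) t :=
      ((h.smooth.continuous.continuousAt.sub continuousAt_const).inv₀ hw).mul
        h.continuous_profileA.continuousAt
    refine hc.congr ?_
    filter_upwards [isOpen_ne.mem_nhds htd] with u hu
    rw [limitPotential, if_neg hu]

theorem tendsto_limitPotential (h : ClassC α Ω a b) (hA : profileA Ω d = 0) {l : Filter ℝ} {c : ℝ}
    (hc : 0 < c) (hl : ∀ᶠ t in l, c ≤ |Ω t - Ω d|) (hAl : Tendsto (profileA Ω) l (𝓝 0)) :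
    Tendsto (limitPotential Ω d) l (𝓝 0) := by
  have hb : Tendsto (fun t => |profileA Ω t| / c) l (𝓝 0) := by
    simpa using hAl.abs.div_const c
  refine squeeze_zero_norm' ?_ hb
  filter_upwards [hl] with t ht
  rw [Real.norm_eq_abs, le_div_iff₀ hc, ← h.limitPotential_mul hA t, abs_mul]
  exact mul_le_mul_of_nonneg_left ht (abs_nonneg _)

theorem exists_eq_left (h : ClassC α Ω a b) : ∃ T c₀ Ωinf : ℝ, 0 < c₀ ∧
    (∀ t < T, Ω t = Ωinf - c₀ * Real.exp (2 * t)) ∧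
    (∀ t < T, deriv Ω t = -(2 * c₀) * Real.exp (2 * t)) ∧
    ∀ t < T, profileA Ω t = -(8 * c₀) * Real.exp (2 * t) := by
  obtain ⟨M₁, M, c₀, Ωinf, -, -, hc₀, hΩ, -⟩ := h.ends
  have hexp : ∀ c t : ℝ, HasDerivAt (fun t => c * Real.exp (2 * t)) (2 * c * Real.exp (2 * t)) t :=
    fun c t => ((((hasDerivAt_id t).const_mul 2).exp).const_mul c).congr_deriv
      (by simp only [id]; ring)
  have h1 : ∀ t < Real.log M₁, deriv Ω t = -(2 * c₀) * Real.exp (2 * t) := by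
    intro t ht
    have hev : Ω =ᶠ[𝓝 t] fun t => Ωinf - c₀ * Real.exp (2 * t) := by
      filter_upwards [Iio_mem_nhds ht] with u hu using hΩ u (le_of_lt hu)
    rw [hev.deriv_eq, ((hexp c₀ t).const_sub Ωinf).deriv]
    ring
  refine ⟨Real.log M₁, c₀, Ωinf, hc₀, fun t ht => hΩ t ht.le, h1, fun t ht => ?_⟩
  have hev : deriv Ω =ᶠ[𝓝 t] fun t => -(2 * c₀) * Real.exp (2 * t) := by
    filter_upwards [Iio_mem_nhds ht] with u hu using h1 u hu
  rw [profileA, hev.deriv_eq, (hexp _ t).deriv, h1 t ht]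
  ring

/-- `A` is the derivative of `Ω' + 2 Ω`, which equals `e^{-αt}` for large `t`; hence `A = -α
e^{-αt}` there. -/
theorem tendsto_profileA_atTop (hα : 0 < α) (h : ClassC α Ω a b) :
    Tendsto (profileA Ω) atTop (𝓝 0) := by
  obtain ⟨M₁, M, c₀, Ωinf, hM₁, hM, -, -, hG⟩ := h.ends
  have hM0 : 0 < M := hM₁.trans hM
  have hlim : Tendsto (fun t => -α * Real.exp (-α * t)) atTop (𝓝 0) := by
    have : Tendsto (fun t : ℝ => -α * t) atTop atBot :=
      tendsto_id.const_mul_atTop_of_neg (by linarith)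
    simpa using (Real.tendsto_exp_atBot.comp this).const_mul (-α)
  refine hlim.congr' ?_
  filter_upwards [eventually_gt_atTop (Real.log M)] with t ht
  have hev : (fun t => deriv Ω t + 2 * Ω t) =ᶠ[𝓝 t] fun t => Real.exp (-α * t) := by
    filter_upwards [Ioi_mem_nhds ht] with u hu
    have hu' : M ≤ Real.exp u := by
      rw [← Real.exp_log hM0]
      exact Real.exp_le_exp.2 (le_of_lt hu)
    have := hG _ hu'
    rw [vorticityProfile, Real.log_exp, ← Real.exp_mul] at this
    rw [this, mul_comm]
  have hd1 := (h.hasDerivAt_deriv t).add ((h.hasDerivAt t).const_mul 2)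
  have hd2 : HasDerivAt (fun t => Real.exp (-α * t)) (-α * Real.exp (-α * t)) t :=
    ((hasDerivAt_id t).const_mul (-α)).exp.congr_deriv (by simp only [id]; ring)
  rw [profileA]
  exact (hd2.congr_of_eventuallyEq hev).unique hd1

theorem tendsto_exp_two_mul_atBot : Tendsto (fun t : ℝ => Real.exp (2 * t)) atBot (𝓝 0) :=
  Real.tendsto_exp_atBot.comp (tendsto_id.const_mul_atBot (by norm_num))

theorem tendsto_profileA_atBot (h : ClassC α Ω a b) : Tendsto (profileA Ω) atBot (𝓝 0) := by
  obtain ⟨T, c₀, Ωinf, -, -, -, hA⟩ := h.exists_eq_left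
  have : Tendsto (fun t => -(8 * c₀) * Real.exp (2 * t)) atBot (𝓝 0) := by
    simpa using tendsto_exp_two_mul_atBot.const_mul (-(8 * c₀))
  refine this.congr' ?_
  filter_upwards [eventually_lt_atBot T] with t ht using (hA t ht).symm

theorem tendsto_deriv_atBot (h : ClassC α Ω a b) : Tendsto (deriv Ω) atBot (𝓝 0) := by
  obtain ⟨T, c₀, Ωinf, -, -, hd, -⟩ := h.exists_eq_left
  have : Tendsto (fun t => -(2 * c₀) * Real.exp (2 * t)) atBot (𝓝 0) := by
    simpa using tendsto_exp_two_mul_atBot.const_mul (-(2 * c₀))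
  refine this.congr' ?_
  filter_upwards [eventually_lt_atBot T] with t ht using (hd t ht).symm

theorem exists_tendsto_atBot (h : ClassC α Ω a b) : ∃ l, Tendsto Ω atBot (𝓝 l) := by
  obtain ⟨T, c₀, Ωinf, -, hΩ, -, -⟩ := h.exists_eq_left
  have : Tendsto (fun t => Ωinf - c₀ * Real.exp (2 * t)) atBot (𝓝 Ωinf) := by
    simpa using (tendsto_exp_two_mul_atBot.const_mul c₀).const_sub Ωinf
  refine ⟨Ωinf, this.congr' ?_⟩
  filter_upwards [eventually_lt_atBot T] with t ht using (hΩ t ht).symm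

/-- The limiting equation has an eigenvalue strictly below `-1`: the case `μ = 1` is solved by the
growing function `e^t (Ω(t) - Ω(d))`, which vanishes at `d`. -/
theorem exists_eigenfunction (hα : 0 < α) (h : ClassC α Ω a b) (hA : profileA Ω d = 0) :
    ∃ μ > 1, ∃ F G : ℝ → ℝ, (∀ t, HasDerivAt F (G t) t) ∧
      (∀ t, HasDerivAt G ((μ + limitPotential Ω d t) * F t) t) ∧
      Integrable (fun t => F t ^ 2) ∧ F ≠ 0 := by
  have hanti := h.strictAnti
  have hleft : ∀ t ≤ d - 1, Ω (d - 1) - Ω d ≤ Ω t - Ω d := fun t ht =>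
    sub_le_sub_right (hanti.antitone ht) _
  have hright : ∀ t ≥ d + 1, Ω t - Ω d ≤ Ω (d + 1) - Ω d := fun t ht =>
    sub_le_sub_right (hanti.antitone ht) _
  have hcl : 0 < Ω (d - 1) - Ω d := sub_pos.2 (hanti (by linarith))
  have hcr : Ω (d + 1) - Ω d < 0 := sub_neg.2 (hanti (by linarith))
  obtain ⟨l, hl⟩ := h.exists_tendsto_atBot
  have hd0 := h.tendsto_deriv_atBot
  have hbot : Tendsto (limitPotential Ω d) atBot (𝓝 0) := by
    refine h.tendsto_limitPotential hA hcl ?_ h.tendsto_profileA_atBot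
    filter_upwards [eventually_le_atBot (d - 1)] with t ht
    exact (hleft t ht).trans (le_abs_self _)
  have htop : Tendsto (limitPotential Ω d) atTop (𝓝 0) := by
    refine h.tendsto_limitPotential hA (neg_pos.2 hcr) ?_ (h.tendsto_profileA_atTop hα)
    filter_upwards [eventually_ge_atTop (d + 1)] with t ht
    exact (neg_le_neg (hright t ht)).trans (neg_le_abs _)
  refine exists_integrable_solution (h.continuous_limitPotential hA) hbot htop (d := d)
    (f := fun t => Real.exp t * (Ω t - Ω d)) (g := fun t => Real.exp t * (Ω t - Ω d + deriv Ω t))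
    (fun t => ?_) (fun t => ?_) (by simp) ?_ ?_ ?_ ?_ ?_ ?_
  · exact ((Real.hasDerivAt_exp t).mul ((h.hasDerivAt t).sub_const _)).congr_deriv (by ring)
  · refine ((Real.hasDerivAt_exp t).mul
      (((h.hasDerivAt t).sub_const _).add (h.hasDerivAt_deriv t))).congr_deriv ?_
    -- The second derivative of `e^t (Ω - Ω(d))` is `e^t (Ω - Ω(d) + A)`, and `A = v (Ω - Ω(d))`.
    have := h.limitPotential_mul hA t
    simp only [profileA] at this
    simp only [Pi.add_apply]
    linear_combination -Real.exp t * this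
  · simp [(h.deriv_neg d).ne]
  · simpa using Real.tendsto_exp_atBot.mul (hl.sub_const (Ω d))
  · simpa using Real.tendsto_exp_atBot.mul ((hl.sub_const (Ω d)).add hd0)
  · filter_upwards [eventually_le_atBot (d - 1)] with t ht
    exact mul_pos (Real.exp_pos t) (hcl.trans_le (hleft t ht))
  -- Near `-∞`, `Ω'` is too small to offset the positive lower bound of `Ω - Ω(d)`.
  · filter_upwards [eventually_le_atBot (d - 1),
      hd0.eventually_const_lt (neg_lt_zero.2 hcl)] with t ht ht'
    exact mul_pos (Real.exp_pos t) (by linarith [hleft t ht])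
  · filter_upwards [eventually_ge_atTop (d + 1)] with t ht
    have h1 : Ω t - Ω d < 0 := (hright t ht).trans_lt hcr
    exact mul_pos_of_neg_of_neg (mul_neg_of_pos_of_neg (Real.exp_pos t) h1)
      (mul_neg_of_pos_of_neg (Real.exp_pos t) (by linarith [h.deriv_neg t]))

end ClassC

end EulerInstability

/-! ### Conclusion -/

theorem proposition4p2 (α : ℝ) (hα₀ : 0 < α) (hα₂ : α < 2) (Ω : ℝ → ℝ) (a b : ℝ)
    (hΩ : EulerInstability.ClassC α Ω a b) (d : ℝ) (hd : d = a ∨ d = b) :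
    ∃ m₀ : ℝ, 1 < m₀ ∧ ∃ ψ : ℝ → ℂ,
      EulerInstability.SolvesLimitingEq Ω d m₀ ψ ∧
      MeasureTheory.MemLp ψ 2 MeasureTheory.volume ∧ ψ ≠ 0 := by
  have hA : EulerInstability.profileA Ω d = 0 := (hΩ.zeros d).2 hd
  obtain ⟨μ, hμ, F, G, hF, hG, hint, hne⟩ := hΩ.exists_eigenfunction hα₀ hA
  have hv := hΩ.continuous_limitPotential hA
  have hFc : Continuous F := continuous_iff_continuousAt.2 fun t => (hF t).continuousAt
  have hF2 : ContDiff ℝ 2 F := by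
    have hdF : deriv F = G := funext fun t => (hF t).deriv
    have hdG : deriv G = fun t => (μ + EulerInstability.limitPotential Ω d t) * F t :=
      funext fun t => (hG t).deriv
    rw [show (2 : WithTop ℕ∞) = 1 + 1 by norm_num, contDiff_succ_iff_deriv]
    refine ⟨fun t => (hF t).differentiableAt, by simp, ?_⟩
    rw [hdF, contDiff_one_iff_deriv]
    refine ⟨fun t => (hG t).differentiableAt, ?_⟩
    rw [hdG]
    fun_prop
  -- `μ` plays the role of `m₀²`, and the real eigenfunction is viewed as complex-valued.
  refine ⟨√μ, Real.lt_sqrt_of_sq_lt (by simpa using hμ), fun t => (F t : ℂ), ⟨?_, fun t => ?_⟩,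
    ?_, ?_⟩
  · exact Complex.ofRealCLM.contDiff.comp hF2
  · have h1 : deriv (fun t => (F t : ℂ)) = fun t => (G t : ℂ) :=
      funext fun t => (hF t).ofReal_comp.deriv
    rw [h1, (hG t).ofReal_comp.deriv, ← Complex.ofReal_pow, Real.sq_sqrt (by linarith)]
    push_cast
    ring
  · refine (MeasureTheory.memLp_two_iff_integrable_sq_norm
      (Complex.continuous_ofReal.comp hFc).aestronglyMeasurable).2 ?_
    simpa using hint
  · intro h
    refine hne (funext fun t => ?_)
    simpa using congrFun h t
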